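/- Let $K$ be a connected compact Lie group with Lie algebra $\mathfrak k$ acting smoothly on a smooth manifold $M$. For $\xi\in\mathfrak k$ let $\xi_M$ be the fundamental vector field, $\xi_{M,m}=\frac{d}{dt}\big|_{t=0}\exp(t\xi)\cdot m$. A differential form $\omega$ on $M$ is called momentumly closed if $d\,\iota_{\xi_M}\omega=0$ for all $\xi\in\mathfrak k$. We say that a form vanishes along an orbit if its restriction to the orbit is zero, i.e. if at every point of the orbit it vanishes on all tuples of vectors tangent to the orbit. (1) If $\omega$ is a smooth $K$-invariant momentumly closed two-form on $M$, then $d\omega$ vanishes along every $K$-orbit. (2) Suppose in addition that $M$ is a complex manifold with complex structure $J$, and that the $K$-action extends to a holomorphic action on $M$ of the complexification $G$ of $K$, i.e. of a complex Lie group $G$ that contains $K$ as a maximal compact subgroup, with $G/K$ connected and $\operatorname{Lie}G=\mathfrak k\oplus i\mathfrak k$. If $\omega$ is a smooth $K$-invariant momentumly closed two-form on $M$ with $\omega(Ju,Jv)=\omega(u,v)$ for all tangent vectors $u,v$ at the same point, then $d\omega$ also vanishes along every $G$-orbit. -/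

import Mathlib

open scoped Manifold ContDiff

noncomputable section

namespace MomentumlyClosed

section Forms

variable {E : Type*} [NormedAddCommGroup E] [NormedSpace ℝ E]
  {M : Type*} [TopologicalSpace M] [ChartedSpace E M] {n : ℕ}

variable (E M n) in
/-- Real differential `n`-forms (not necessarily smooth) on the manifold `M` modelled on `E`. -/
abbrev DiffForm : Type _ :=
  ∀ x : M, TangentSpace 𝓘(ℝ, E) x [⋀^Fin n]→L[ℝ] ℝ

/-- The expression of a form in the preferred chart at `x₀`: its pullback under the inverse of
the chart, a form on the model space (meaningful on the target of the chart). -/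
def DiffForm.inChart (α : DiffForm E M n) (x₀ : M) : E → E [⋀^Fin n]→L[ℝ] ℝ := fun y =>
  (α ((extChartAt 𝓘(ℝ, E) x₀).symm y)).compContinuousLinearMap
    (mfderiv 𝓘(ℝ, E) 𝓘(ℝ, E) (extChartAt 𝓘(ℝ, E) x₀).symm y)

/-- A form is smooth if its expressions in charts are. -/
def DiffForm.IsSmooth (α : DiffForm E M n) : Prop :=
  ∀ x₀ : M, ContDiffOn ℝ ∞ (α.inChart x₀) (extChartAt 𝓘(ℝ, E) x₀).target

/-- The exterior derivative, computed at each point in the preferred chart at this point. -/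
def DiffForm.d (α : DiffForm E M n) : DiffForm E M (n + 1) := fun x =>
  (extDeriv (α.inChart x) (extChartAt 𝓘(ℝ, E) x x)).compContinuousLinearMap
    (mfderiv 𝓘(ℝ, E) 𝓘(ℝ, E) (extChartAt 𝓘(ℝ, E) x) x)

/-- The pullback `f^* α` under a self-map of `M`. -/
def DiffForm.pullback (f : M → M) (α : DiffForm E M n) : DiffForm E M n := fun x =>
  (α (f x)).compContinuousLinearMap (mfderiv 𝓘(ℝ, E) 𝓘(ℝ, E) f x)

/-- The contraction `ι_X α = α(X, ·, …, ·)` with a vector field `X`. -/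
def DiffForm.contract (X : ∀ x : M, TangentSpace 𝓘(ℝ, E) x) (α : DiffForm E M (n + 1)) :
    DiffForm E M n := fun x =>
  { (α x).toAlternatingMap.curryLeft (X x) with
    cont := (α x).cont.comp (continuous_const.finCons continuous_id) }

end Forms

section Actions

variable {E : Type*} [NormedAddCommGroup E] [NormedSpace ℝ E]
  {M : Type*} [TopologicalSpace M] [ChartedSpace E M] {n : ℕ}
  {EL : Type*} [NormedAddCommGroup EL] [NormedSpace ℝ EL]
  (L : Type*) [TopologicalSpace L] [ChartedSpace EL L] [Group L] [MulAction L M]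

variable {L} in
/-- The fundamental vector field `ξ_M` of `ξ ∈ Lie L = T_1 L`: its value at `m` is the image of `ξ`
under the differential at `1` of the orbit map `g ↦ g • m`, that is, the velocity at `t = 0` of
`exp (t ξ) • m`. (The spaces `T_{1 • m} M` and `T_m M` are definitionally equal.) -/
def fundamentalField (ξ : GroupLieAlgebra 𝓘(ℝ, EL) L) (m : M) : TangentSpace 𝓘(ℝ, E) m :=
  mfderiv 𝓘(ℝ, EL) 𝓘(ℝ, E) (fun g : L => g • m) 1 ξ

/-- The form `α` is invariant under the action of `L`. -/
def DiffForm.IsInvariant (α : DiffForm E M n) : Prop :=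
  ∀ g : L, α.pullback (fun m : M => g • m) = α

variable (EL) in
/-- The form `α` is momentumly closed with respect to the action of `L`: the contraction of `α`
with every fundamental vector field is closed. -/
def DiffForm.IsMomentumlyClosed (α : DiffForm E M (n + 1)) : Prop :=
  ∀ ξ : GroupLieAlgebra 𝓘(ℝ, EL) L, (α.contract (fundamentalField ξ)).d = 0

variable (E EL) in
/-- The tangent space at `p` of the `L`-orbit through `p`. -/
def orbitTangentSpace (p : M) : Set (TangentSpace 𝓘(ℝ, E) p) :=
  Set.range fun ξ : GroupLieAlgebra 𝓘(ℝ, EL) L => fundamentalField ξ p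

variable (EL) in
/-- The form `α` vanishes along every `L`-orbit: its restriction to the tangent spaces of each
orbit is zero. -/
def DiffForm.VanishesAlongOrbits (α : DiffForm E M n) : Prop :=
  ∀ m : M, ∀ p ∈ MulAction.orbit L m, ∀ v : Fin n → TangentSpace 𝓘(ℝ, E) p,
    (∀ i, v i ∈ orbitTangentSpace E EL L p) → α p v = 0

end Actions

section Complex

variable {E : Type*} [NormedAddCommGroup E] [NormedSpace ℂ E]
  {M : Type*} [TopologicalSpace M] [ChartedSpace E M]

variable (E) in
/-- The complex structure `J` on the real tangent spaces of a manifold modelled on a complex vector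
space `E`: multiplication by `i` in the tangent space, which is `E` itself, read in the
preferred chart. -/
def J (m : M) : TangentSpace 𝓘(ℝ, E) m →L[ℝ] TangentSpace 𝓘(ℝ, E) m :=
  (Complex.I • ContinuousLinearMap.id ℝ E : E →L[ℝ] E)

/-- A two-form is `J`-invariant if `α(Ju, Jv) = α(u, v)` for all tangent vectors `u, v`. -/
def DiffForm.IsJInvariant (α : DiffForm E M 2) : Prop :=
  ∀ (m : M) (u v : TangentSpace 𝓘(ℝ, E) m), α m ![J E m u, J E m v] = α m ![u, v]

variable {EK : Type*} [NormedAddCommGroup EK] [NormedSpace ℝ EK]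
  {K : Type*} [TopologicalSpace K] [ChartedSpace EK K] [Group K]
  {EG : Type*} [NormedAddCommGroup EG] [NormedSpace ℂ EG]
  {G : Type*} [TopologicalSpace G] [ChartedSpace EG G] [Group G]

variable (EK EG) in
/-- The differential at `1` of a homomorphism `φ : K → G`, as a map `Lie K → Lie G`. (The spaces
`T_{φ 1} G` and `T_1 G` are definitionally equal.) -/
def lieMap (φ : K →* G) : GroupLieAlgebra 𝓘(ℝ, EK) K →L[ℝ] GroupLieAlgebra 𝓘(ℝ, EG) G :=
  mfderiv 𝓘(ℝ, EK) 𝓘(ℝ, EG) φ 1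

variable (EK EG) in
/-- The homomorphism `φ : K → G` of a compact Lie group `K` to a complex Lie group `G` exhibits `G`
as the complexification of `K`: it is smooth and injective, its image is a maximal compact subgroup
of `G`, the quotient `G / K` is connected, and `Lie G = Lie K ⊕ i Lie K`. -/
structure IsComplexification (φ : K →* G) : Prop where
  contMDiff : ContMDiff 𝓘(ℝ, EK) 𝓘(ℝ, EG) ∞ φ
  injective : Function.Injective φ
  isCompact_range : IsCompact (φ.range : Set G)
  maximal : ∀ L : Subgroup G, φ.range ≤ L → IsCompact (L : Set G) → L = φ.range
  connected : ConnectedSpace (G ⧸ φ.range)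
  isCompl : IsCompl (lieMap EK EG φ).range
    ((lieMap EK EG φ).range.map (J EG (1 : G)).toLinearMap)

end Complex

end MomentumlyClosed

end

noncomputable section

namespace MomentumlyClosed

open Filter Topology

/-! ### Calculus of two-forms on a normed space. -/

section Flat

variable {E : Type*} [NormedAddCommGroup E] [NormedSpace ℝ E]

/-! By Cartan's formula, invariance gives `0 = ι_X dω + d ι_X ω` for every fundamental field `X` of
`K`. The second term vanishes because `ω` is momentumly closed, so `dω` is zero as soon as one
argument is tangent to a `K`-orbit (`d_apply_eq_zero_of_mem_orbitTangentSpace`). This contains part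
(1).

For part (2), a tangent vector of a `G`-orbit is `a + J a'` with `a, a'` tangent to the `K`-orbit,
since `Lie G` is spanned by `Lie K` and `i Lie K` and orbit maps are holomorphic. Expanding `dω` on
three such vectors leaves only `dω(Ja', Jb', Jc')`. As `ω` is of type (1,1), `dω` has no (3,0) and
(0,3) parts, which expresses this value as a sum of values with only one `J` each
(`DiffForm.IsJInvariant.d_apply`). These vanish too.

Cartan's formula is proved in a chart, without flows: only a family of local maps is needed that
starts at the identity, preserves the form and has initial velocity `X`. Any curve in `K` through
`1` with velocity `ξ` provides one, so the exponential map does not occur. -/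

lemma fderiv_two_form_apply {V : Type*} [NormedAddCommGroup V] [NormedSpace ℝ V]
    {β : V → E [⋀^Fin 2]→L[ℝ] ℝ} {a b : V → E} {x : V}
    (hβ : DifferentiableAt ℝ β x) (ha : DifferentiableAt ℝ a x) (hb : DifferentiableAt ℝ b x)
    (v : V) :
    fderiv ℝ (fun y => β y ![a y, b y]) x v =
      fderiv ℝ β x v ![a x, b x] + β x ![fderiv ℝ a x v, b x] + β x ![a x, fderiv ℝ b x v] := by
  have hg : ∀ i, DifferentiableAt ℝ ((![a, b] : Fin 2 → V → E) i) x := by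
    intro i
    fin_cases i
    exacts [ha, hb]
  have e : ∀ y, (fun i => (![a, b] : Fin 2 → V → E) i y) = ![a y, b y] := by
    intro y
    funext i
    fin_cases i <;> rfl
  have h := fderiv_continuousAlternatingMap_apply_apply hβ hg v
  simp only [e] at h
  rw [h, Fin.sum_univ_two, ← add_assoc]
  congr 3
  all_goals
    funext i
    fin_cases i <;> rfl

lemma extDeriv_two_form_apply {β : E → E [⋀^Fin 2]→L[ℝ] ℝ} {x : E} (u v w : E) :
    extDeriv β x ![u, v, w] =
      fderiv ℝ β x u ![v, w] - fderiv ℝ β x v ![u, w] + fderiv ℝ β x w ![u, v] := by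
  have e0 : (0 : Fin 3).removeNth ![u, v, w] = ![v, w] := by
    funext i; fin_cases i <;> rfl
  have e1 : (1 : Fin 3).removeNth ![u, v, w] = ![u, w] := by
    funext i; fin_cases i <;> rfl
  have e2 : (2 : Fin 3).removeNth ![u, v, w] = ![u, v] := by
    funext i; fin_cases i <;> rfl
  rw [extDeriv, ContinuousAlternatingMap.alternatizeUncurryFin_apply, Fin.sum_univ_three, e0, e1,
    e2]
  simp
  ring

lemma extDeriv_one_form_apply {β : E → E [⋀^Fin 1]→L[ℝ] ℝ} {x : E} (v w : E) :
    extDeriv β x ![v, w] = fderiv ℝ β x v ![w] - fderiv ℝ β x w ![v] := by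
  have e0 : (0 : Fin 2).removeNth ![v, w] = ![w] := by
    funext i; fin_cases i; rfl
  have e1 : (1 : Fin 2).removeNth ![v, w] = ![v] := by
    funext i; fin_cases i; rfl
  rw [extDeriv, ContinuousAlternatingMap.alternatizeUncurryFin_apply, Fin.sum_univ_two, e0, e1]
  simp
  ring

lemma two_form_swap (β : E [⋀^Fin 2]→L[ℝ] ℝ) (v w : E) : β ![v, w] = -β ![w, v] := by
  have h := β.map_swap ![w, v] (i := 0) (j := 1) (by decide)
  refine Eq.trans (congrArg β ?_) h
  funext i
  fin_cases i <;> rfl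

/-- Cartan's formula for a one-parameter family of local diffeomorphisms preserving `β`. -/
lemma extDeriv_add_extDeriv_curryLeft {β : E → E [⋀^Fin 2]→L[ℝ] ℝ} {F : ℝ × E → E} {x : E}
    (hβ : DifferentiableAt ℝ β x) (hF : ContDiffAt ℝ 2 F (0, x))
    (hF0 : ∀ᶠ y in 𝓝 x, F (0, y) = y)
    (hinv : ∀ᶠ t in 𝓝 (0 : ℝ), ∀ v w, β (F (t, x)) ![fderiv ℝ F (t, x) (0, v),
      fderiv ℝ F (t, x) (0, w)] = β x ![v, w]) (v w : E) :
    extDeriv β x ![fderiv ℝ F (0, x) (1, 0), v, w] +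
      extDeriv (fun y => (β y).curryLeft (fderiv ℝ F (0, y) (1, 0))) x ![v, w] = 0 := by
  have hx : F (0, x) = x := hF0.self_of_nhds
  have hFd : DifferentiableAt ℝ F (0, x) := hF.differentiableAt two_ne_zero
  have hF' : DifferentiableAt ℝ (fderiv ℝ F) (0, x) :=
    (hF.fderiv_right (m := 1) (by norm_num)).differentiableAt one_ne_zero
  have hsymm := hF.isSymmSndFDerivAt (by simp)
  set X : E → E := fun y => fderiv ℝ F (0, y) (1, 0) with hX
  have hincl : ∀ y : E, HasFDerivAt (fun y : E => ((0 : ℝ), y)) (.inr ℝ ℝ E) y := fun y =>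
    hasFDerivAt_prodMk_right 0 y
  have hline : HasFDerivAt (fun t : ℝ => (t, x)) (.inl ℝ ℝ E) 0 := hasFDerivAt_prodMk_left 0 x
  have hXd : HasFDerivAt X ((fderiv ℝ (fderiv ℝ F) (0, x)).flip (1, 0) ∘L .inr ℝ ℝ E) x := by
    have h1 := hF'.hasFDerivAt.comp x (hincl x)
    have h2 := h1.clm_apply (hasFDerivAt_const ((1, 0) : ℝ × E) x)
    refine h2.congr_fderiv ?_
    ext z
    simp
  -- the derivative of the invariance relation
  have hid : ∀ z, fderiv ℝ F (0, x) (0, z) = z := by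
    intro z
    have h1 := hFd.hasFDerivAt.comp x (hincl x)
    have h2 : HasFDerivAt (F ∘ fun y : E => ((0 : ℝ), y)) (.id ℝ E) x :=
      (hasFDerivAt_id x).congr_of_eventuallyEq hF0
    simpa using congrArg (fun l => l z) (h1.unique h2)
  have hA : ∀ z, HasFDerivAt (fun t : ℝ => fderiv ℝ F (t, x) (0, z))
      ((fderiv ℝ (fderiv ℝ F) (0, x)).flip (0, z) ∘L .inl ℝ ℝ E) 0 := by
    intro z
    have h1 := hF'.hasFDerivAt.comp (0 : ℝ) hline
    have h2 := h1.clm_apply (hasFDerivAt_const ((0, z) : ℝ × E) (0 : ℝ))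
    refine h2.congr_fderiv ?_
    ext
    simp
  -- Mixed partial derivatives commute: the time derivative of the spatial differential of `F` is
  -- the spatial differential of its velocity.
  have hA1 : ∀ z, fderiv ℝ (fun t : ℝ => fderiv ℝ F (t, x) (0, z)) 0 1 = fderiv ℝ X x z := by
    intro z
    rw [(hA z).fderiv, hXd.fderiv]
    simpa using hsymm.eq (1, 0) (0, z)
  have hβF : HasFDerivAt (fun t : ℝ => β (F (t, x)))
      (fderiv ℝ β x ∘L fderiv ℝ F (0, x) ∘L .inl ℝ ℝ E) 0 := by
    have h1 := hFd.hasFDerivAt.comp (0 : ℝ) hline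
    have h2 : HasFDerivAt β (fderiv ℝ β x) ((F ∘ fun t : ℝ => (t, x)) 0) := by
      simpa [hx] using hβ.hasFDerivAt
    exact h2.comp (0 : ℝ) h1
  -- The left side is the Lie derivative of `β` along `X` in coordinates.
  have hL : fderiv ℝ β x (X x) ![v, w] + β x ![fderiv ℝ X x v, w] + β x ![v, fderiv ℝ X x w] = 0 := by
    have h1 := fderiv_two_form_apply hβF.differentiableAt (hA v).differentiableAt
      (hA w).differentiableAt 1
    have h2 : (fun t : ℝ => β (F (t, x)) ![fderiv ℝ F (t, x) (0, v), fderiv ℝ F (t, x) (0, w)])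
        =ᶠ[𝓝 0] fun _ => β x ![v, w] := hinv.mono fun t ht => ht v w
    rw [h2.fderiv_eq, hA1, hA1, hβF.fderiv, hid, hid, hx] at h1
    simpa [hX] using h1.symm
  let C : (E [⋀^Fin 2]→L[ℝ] ℝ) →L[ℝ] E →L[ℝ] E [⋀^Fin 1]→L[ℝ] ℝ :=
    (ContinuousAlternatingMap.curryLeftLI (𝕜 := ℝ) (E := E) (F := ℝ)
      (n := 1)).toContinuousLinearMap
  have hcurry : HasFDerivAt (fun y => (β y).curryLeft) (C ∘L fderiv ℝ β x) x :=
    HasFDerivAt.comp (g := fun f : E [⋀^Fin 2]→L[ℝ] ℝ => f.curryLeft) x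
      (ContinuousLinearMap.hasFDerivAt (F := E →L[ℝ] E [⋀^Fin 1]→L[ℝ] ℝ) C) hβ.hasFDerivAt
  have hc := hcurry.clm_apply hXd
  have hc1 : ∀ a b, fderiv ℝ (fun y => (β y).curryLeft (X y)) x a ![b] =
      fderiv ℝ β x a ![X x, b] + β x ![fderiv ℝ X x a, b] := by
    intro a b
    rw [hc.fderiv, hXd.fderiv]
    simp [C]
    ring
  rw [extDeriv_two_form_apply, extDeriv_one_form_apply, hc1, hc1]
  have := two_form_swap (β x) v (fderiv ℝ X x w)
  linarith

/-- The exterior derivative of a two-form of type `(1,1)` has no components of type `(3,0)` and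
`(0,3)`. -/
lemma extDeriv_apply_of_invariant {β : E → E [⋀^Fin 2]→L[ℝ] ℝ} {x : E} {j : E →L[ℝ] E}
    (hj : ∀ v, j (j v) = -v) (hβ : DifferentiableAt ℝ β x)
    (hinv : ∀ᶠ y in 𝓝 x, ∀ v w, β y ![j v, j w] = β y ![v, w]) (u v w : E) :
    extDeriv β x ![j u, j v, j w] =
      extDeriv β x ![u, v, j w] + extDeriv β x ![u, j v, w] + extDeriv β x ![j u, v, w] := by
  -- Since `j` is constant, the derivatives of `β` inherit its invariance. With `j² = -1`, the terms
  -- on the right differentiated along a vector without `j` then cancel in pairs.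
  have h1 : ∀ a b c, fderiv ℝ β x a ![j b, j c] = fderiv ℝ β x a ![b, c] := by
    intro a b c
    rw [← fderiv_continuousAlternatingMap_apply_const_apply hβ,
      ← fderiv_continuousAlternatingMap_apply_const_apply hβ]
    have : (fun y => β y ![j b, j c]) =ᶠ[𝓝 x] fun y => β y ![b, c] := hinv.mono fun y hy => hy b c
    rw [this.fderiv_eq]
  have h2 : ∀ a b c, fderiv ℝ β x a ![j b, c] = - fderiv ℝ β x a ![b, j c] := by
    intro a b c
    rw [← h1 a (j b) c, hj, ← neg_one_smul ℝ b]
    exact ((fderiv ℝ β x a).toAlternatingMap.map_vecCons_smul ![j c] (-1) b).trans (by simp)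
  simp only [extDeriv_two_form_apply, h1]
  rw [h2 u v w, h2 v u w, h2 w u v]
  ring

end Flat

/-! ### Passage to charts and Cartan's formula on a manifold. -/

section Manifold

variable {E : Type*} [NormedAddCommGroup E] [NormedSpace ℝ E]
  {M : Type*} [TopologicalSpace M] [ChartedSpace E M]

lemma DiffForm.IsSmooth.differentiableAt_inChart {n : ℕ} {α : DiffForm E M n} (hα : α.IsSmooth)
    (m : M) : DifferentiableAt ℝ (α.inChart m) (extChartAt 𝓘(ℝ, E) m m) :=
  ((hα m).contDiffAt (extChartAt_target_mem_nhds m)).differentiableAt (by simp)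

lemma DiffForm.inChart_two_apply (α : DiffForm E M 2) (m : M) (y v w : E) :
    α.inChart m y ![v, w] = α ((extChartAt 𝓘(ℝ, E) m).symm y)
      ![mfderiv 𝓘(ℝ, E) 𝓘(ℝ, E) (extChartAt 𝓘(ℝ, E) m).symm y v,
        mfderiv 𝓘(ℝ, E) 𝓘(ℝ, E) (extChartAt 𝓘(ℝ, E) m).symm y w] := by
  refine congrArg (α ((extChartAt 𝓘(ℝ, E) m).symm y)) ?_
  funext i
  fin_cases i <;> rfl

section

variable [IsManifold 𝓘(ℝ, E) ∞ M]

/-- The tangent space at `m` is the model space read through the preferred chart at `m`, so at this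
one point chart computations need no correction. -/
lemma mfderiv_extChartAt_symm_self (m : M) :
    (mfderiv 𝓘(ℝ, E) 𝓘(ℝ, E) (extChartAt 𝓘(ℝ, E) m).symm (extChartAt 𝓘(ℝ, E) m m) : E →L[ℝ] E) =
      ContinuousLinearMap.id ℝ E := by
  have : IsManifold 𝓘(ℝ, E) 1 M := .of_le (n := ∞) (by simp)
  have h := mfderivWithin_range_extChartAt_symm (I := 𝓘(ℝ, E)) (x := m)
  rwa [modelWithCornersSelf_coe, Set.range_id, mfderivWithin_univ] at h

lemma DiffForm.d_apply {n : ℕ} (α : DiffForm E M n) (m : M)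
    (v : Fin (n + 1) → TangentSpace 𝓘(ℝ, E) m) :
    α.d m v = extDeriv (α.inChart m) (extChartAt 𝓘(ℝ, E) m m) v := by
  have : IsManifold 𝓘(ℝ, E) 1 M := .of_le (n := ∞) (by simp)
  rw [DiffForm.d, mfderiv_extChartAt_self]
  rfl

end

lemma DiffForm.inChart_contract_apply {n : ℕ} (α : DiffForm E M (n + 1))
    (X : ∀ x : M, TangentSpace 𝓘(ℝ, E) x) (m : M) {y u : E}
    (hu : mfderiv 𝓘(ℝ, E) 𝓘(ℝ, E) (extChartAt 𝓘(ℝ, E) m).symm y u =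
      X ((extChartAt 𝓘(ℝ, E) m).symm y)) :
    (α.contract X).inChart m y = (α.inChart m y).curryLeft u := by
  ext v
  refine congrArg (α ((extChartAt 𝓘(ℝ, E) m).symm y)) ?_
  funext i
  refine Fin.cases ?_ (fun j => ?_) i
  · exact hu.symm
  · rfl

/-- There is a smooth curve through `g` with given velocity. -/
lemma exists_curve {EK : Type*} [NormedAddCommGroup EK] [NormedSpace ℝ EK]
    {K : Type*} [TopologicalSpace K] [ChartedSpace EK K] [IsManifold 𝓘(ℝ, EK) ∞ K]
    (g : K) (ξ : EK) :
    ∃ c : ℝ → K, c 0 = g ∧ ContMDiffAt 𝓘(ℝ, ℝ) 𝓘(ℝ, EK) ∞ c 0 ∧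
      (mfderiv 𝓘(ℝ, ℝ) 𝓘(ℝ, EK) c 0 (1 : ℝ) : EK) = ξ := by
  let e := extChartAt 𝓘(ℝ, EK) g
  let l : ℝ → EK := fun t => e g + t • ξ
  have hl0 : l 0 = e g := by simp [l]
  have hl : ContDiff ℝ ∞ l := by fun_prop
  have hs : ContMDiffAt 𝓘(ℝ, EK) 𝓘(ℝ, EK) ∞ e.symm (l 0) := by
    rw [hl0]
    exact (contMDiffOn_extChartAt_symm g).contMDiffAt (extChartAt_target_mem_nhds g)
  refine ⟨e.symm ∘ l, by simp [hl0, e], hs.comp 0 hl.contMDiff.contMDiffAt, ?_⟩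
  have hl' : HasFDerivAt l (ContinuousLinearMap.toSpanSingleton ℝ ξ) 0 := by
    have := ((hasFDerivAt_id (𝕜 := ℝ) (0 : ℝ)).smul_const ξ).const_add (e g)
    refine this.congr_fderiv ?_
    ext
    simp
  have h1 : HasMFDerivAt 𝓘(ℝ, ℝ) 𝓘(ℝ, EK) (e.symm ∘ l) 0 _ :=
    (hs.mdifferentiableAt (by simp)).hasMFDerivAt.comp 0 hl'.hasMFDerivAt
  rw [h1.mfderiv]
  have h2 : (mfderiv 𝓘(ℝ, EK) 𝓘(ℝ, EK) e.symm (l 0) : EK →L[ℝ] EK) = .id ℝ EK := by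
    rw [hl0]
    exact mfderiv_extChartAt_symm_self g
  change (mfderiv 𝓘(ℝ, EK) 𝓘(ℝ, EK) e.symm (l 0) : EK →L[ℝ] EK) ((1 : ℝ) • ξ) = ξ
  rw [h2, one_smul]
  rfl

variable [IsManifold 𝓘(ℝ, E) ∞ M]
  {EK : Type*} [NormedAddCommGroup EK] [NormedSpace ℝ EK]
  {K : Type*} [TopologicalSpace K] [ChartedSpace EK K] [Group K] [LieGroup 𝓘(ℝ, EK) ∞ K]
  [MulAction K M] [ContMDiffSMul 𝓘(ℝ, EK) 𝓘(ℝ, E) ∞ K M]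

/-- Cartan's formula for an invariant two-form. -/
theorem DiffForm.IsInvariant.d_apply_fundamentalField {α : DiffForm E M 2}
    (hα : α.IsSmooth) (hK : α.IsInvariant K) (ξ : GroupLieAlgebra 𝓘(ℝ, EK) K) (m : M)
    (v w : TangentSpace 𝓘(ℝ, E) m) :
    α.d m ![fundamentalField ξ m, v, w] + (α.contract (fundamentalField ξ)).d m ![v, w] = 0 := by
  obtain ⟨c, hc0, hc, hcξ⟩ := exists_curve (EK := EK) (1 : K) ξ
  have hc' := hc.mdifferentiableAt (by simp)
  let e := extChartAt 𝓘(ℝ, E) m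
  let y₀ : E := e m
  have hsmul : ContMDiff (𝓘(ℝ, EK).prod 𝓘(ℝ, E)) 𝓘(ℝ, E) ∞ fun p : K × M => p.1 • p.2 :=
    contMDiff_smul
  -- The action of the curve `c`, read in the chart at `m`.
  let F : ℝ × E → E := fun p => e (c p.1 • e.symm p.2)
  have hem : e.symm y₀ = m := extChartAt_to_inv m
  have hsymm : ∀ y ∈ e.target, ContMDiffAt 𝓘(ℝ, E) 𝓘(ℝ, E) ∞ e.symm y := fun y hy =>
    (contMDiffOn_extChartAt_symm m).contMDiffAt (extChartAt_target_mem_nhds' hy)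
  have hy₀t : y₀ ∈ e.target := mem_extChartAt_target m
  have hP : ContMDiffAt 𝓘(ℝ, ℝ × E) 𝓘(ℝ, E) ∞ (fun p : ℝ × E => c p.1 • e.symm p.2) (0, y₀) := by
    have h1 : ContMDiffAt 𝓘(ℝ, ℝ × E) 𝓘(ℝ, EK) ∞ (fun p : ℝ × E => c p.1) (0, y₀) :=
      ContMDiffAt.comp (g := c) (f := Prod.fst) (0, y₀) hc contDiff_fst.contMDiff.contMDiffAt
    have h2 : ContMDiffAt 𝓘(ℝ, ℝ × E) 𝓘(ℝ, E) ∞ (fun p : ℝ × E => e.symm p.2) (0, y₀) :=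
      ContMDiffAt.comp (g := e.symm) (f := Prod.snd) (0, y₀) (hsymm y₀ hy₀t)
        contDiff_snd.contMDiff.contMDiffAt
    exact hsmul.contMDiffAt.comp (0, y₀) (h1.prodMk h2)
  have hP0 : c (0, y₀).1 • e.symm (0, y₀).2 = m := by simp [hc0, hem]
  have hF : ContDiffAt ℝ ∞ F (0, y₀) := by
    refine ContMDiffAt.contDiffAt (ContMDiffAt.comp (g := e) (0, y₀) ?_ hP)
    rw [hP0]
    exact contMDiffAt_extChartAt
  have hF2 : ContDiffAt ℝ 2 F (0, y₀) := hF.of_le ENat.LEInfty.out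
  -- on a neighbourhood of `(0, y₀)` everything stays in the chart
  have hnear : ∀ᶠ p : ℝ × E in 𝓝 (0, y₀), DifferentiableAt ℝ F p ∧ p.2 ∈ e.target ∧
      ∀ᶠ q in 𝓝 p, c q.1 • e.symm q.2 ∈ e.source := by
    have h1 : ∀ᶠ p in 𝓝 ((0 : ℝ), y₀), DifferentiableAt ℝ F p :=
      (hF2.eventually (by simp)).mono fun p hp => hp.differentiableAt two_ne_zero
    have h2 : ∀ᶠ p : ℝ × E in 𝓝 (0, y₀), p.2 ∈ e.target :=
      (continuous_snd.tendsto ((0 : ℝ), y₀)).eventually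
        (extChartAt_target_mem_nhds (I := 𝓘(ℝ, E)) m)
    have h3 : ∀ᶠ q : ℝ × E in 𝓝 (0, y₀), c q.1 • e.symm q.2 ∈ e.source := by
      have h : e.source ∈ 𝓝 (c (0, y₀).1 • e.symm (0, y₀).2) := by
        rw [hP0]
        exact extChartAt_source_mem_nhds m
      exact hP.continuousAt.eventually h
    exact h1.and (h2.and h3.eventually_nhds)
  have hslice : ∀ᶠ y in 𝓝 y₀, DifferentiableAt ℝ F (0, y) ∧ y ∈ e.target ∧
      ∀ᶠ q in 𝓝 ((0 : ℝ), y), c q.1 • e.symm q.2 ∈ e.source :=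
    (Continuous.prodMk_right (0 : ℝ)).continuousAt.eventually hnear
  have hline : ∀ᶠ t in 𝓝 (0 : ℝ), DifferentiableAt ℝ F (t, y₀) ∧ y₀ ∈ e.target ∧
      ∀ᶠ q in 𝓝 (t, y₀), c q.1 • e.symm q.2 ∈ e.source :=
    (Continuous.prodMk_left y₀).continuousAt.eventually hnear
  have hF0 : ∀ y ∈ e.target, F (0, y) = y := by
    intro y hy
    simp only [F, hc0, one_smul]
    exact e.right_inv hy
  -- Chain rule on both sides of `e.symm (F (t, y)) = c t • e.symm y`, differentiated in `t` at `0`.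
  have hX : ∀ᶠ y in 𝓝 y₀, (mfderiv 𝓘(ℝ, E) 𝓘(ℝ, E) e.symm y (fderiv ℝ F (0, y) (1, 0)) : E) =
      fundamentalField ξ (e.symm y) := by
    filter_upwards [hslice] with y hy
    obtain ⟨hFy, hyt, hq⟩ := hy
    have h1 : HasMFDerivAt 𝓘(ℝ, ℝ) 𝓘(ℝ, E) (fun t : ℝ => F (t, y)) 0
        (fderiv ℝ F (0, y) ∘L .inl ℝ ℝ E) :=
      (HasFDerivAt.comp (g := F) (f := fun t : ℝ => (t, y)) (0 : ℝ) hFy.hasFDerivAt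
        (hasFDerivAt_prodMk_left 0 y)).hasMFDerivAt
    have h2 : HasMFDerivAt 𝓘(ℝ, E) 𝓘(ℝ, E) e.symm (F (0, y))
        (mfderiv 𝓘(ℝ, E) 𝓘(ℝ, E) e.symm y) := by
      rw [hF0 y hyt]
      exact ((hsymm y hyt).mdifferentiableAt (by simp)).hasMFDerivAt
    have h3 := h2.comp (0 : ℝ) h1
    have h4 : MDifferentiableAt 𝓘(ℝ, EK) 𝓘(ℝ, E) (fun g : K => g • e.symm y) (c 0) :=
      ((hsmul.comp (contMDiff_id.prodMk contMDiff_const)).mdifferentiable (by simp)) _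
    have h5 := h4.hasMFDerivAt.comp (0 : ℝ) hc'.hasMFDerivAt
    have h6 : (e.symm ∘ fun t : ℝ => F (t, y)) =ᶠ[𝓝 0] ((fun g : K => g • e.symm y) ∘ c) := by
      have := (Continuous.prodMk_left y).continuousAt.eventually hq
      filter_upwards [this] with t ht
      exact e.left_inv ht
    have h7 := hasMFDerivAt_unique (h3.congr_of_eventuallyEq h6.symm) h5
    have h8 := congrArg (fun l : ℝ →L[ℝ] E => l 1) h7
    -- Base points that are equal only propositionally are generalized to variables, since rewriting
    -- them inside dependent tangent spaces fails.
    have h9 : ∀ g : K, g = 1 → ∀ u : EK, u = ξ →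
        (mfderiv 𝓘(ℝ, EK) 𝓘(ℝ, E) (fun g : K => g • e.symm y) g u : E) =
          fundamentalField ξ (e.symm y) := by
      rintro _ rfl _ rfl
      rfl
    exact h8.trans (h9 _ hc0 _ hcξ)
  have hinv : ∀ᶠ t in 𝓝 (0 : ℝ), ∀ v w, α.inChart m (F (t, y₀)) ![fderiv ℝ F (t, y₀) (0, v),
      fderiv ℝ F (t, y₀) (0, w)] = α.inChart m y₀ ![v, w] := by
    filter_upwards [hline] with t ht
    obtain ⟨hFt, -, hq⟩ := ht
    intro v w
    -- The same identity, now differentiated in `y` at fixed `t`.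
    have hder : ∀ z : E, (mfderiv 𝓘(ℝ, E) 𝓘(ℝ, E) e.symm (F (t, y₀))
        (fderiv ℝ F (t, y₀) (0, z)) : E) =
        mfderiv 𝓘(ℝ, E) 𝓘(ℝ, E) (fun p : M => c t • p) m z := by
      have h1 : HasMFDerivAt 𝓘(ℝ, E) 𝓘(ℝ, E) (fun y : E => F (t, y)) y₀
          (fderiv ℝ F (t, y₀) ∘L .inr ℝ ℝ E) :=
        (hFt.hasFDerivAt.comp y₀ (hasFDerivAt_prodMk_right t y₀)).hasMFDerivAt
      have h2 := ((hsymm (F (t, y₀)) (e.map_source hq.self_of_nhds)).mdifferentiableAt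
        (by simp)).hasMFDerivAt
      have h3 := h2.comp y₀ h1
      have h4 : MDifferentiableAt 𝓘(ℝ, E) 𝓘(ℝ, E) (fun p : M => c t • p) (e.symm y₀) :=
        ((hsmul.comp (contMDiff_const.prodMk contMDiff_id)).mdifferentiable (by simp)) _
      have h5 := h4.hasMFDerivAt.comp y₀
        ((hsymm y₀ hy₀t).mdifferentiableAt (by simp)).hasMFDerivAt
      have h6 : (e.symm ∘ fun y : E => F (t, y)) =ᶠ[𝓝 y₀] ((fun p : M => c t • p) ∘ e.symm) := by
        have := (Continuous.prodMk_right t).continuousAt.eventually hq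
        filter_upwards [this] with y hy
        exact e.left_inv hy
      have h7 := hasMFDerivAt_unique (h3.congr_of_eventuallyEq h6.symm) h5
      intro z
      have h8 := congrArg (fun l : E →L[ℝ] E => l z) h7
      have h9 : ∀ p : M, p = m → ∀ A : E →L[ℝ] E, A = .id ℝ E →
          (mfderiv 𝓘(ℝ, E) 𝓘(ℝ, E) (fun p : M => c t • p) p (A z) : E) =
            mfderiv 𝓘(ℝ, E) 𝓘(ℝ, E) (fun p : M => c t • p) m z := by
        rintro _ rfl _ rfl
        rfl
      exact h8.trans (h9 _ hem _ (mfderiv_extChartAt_symm_self m))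
    let α' : M → E [⋀^Fin 2]→L[ℝ] ℝ := α
    have hα1 : α.inChart m (F (t, y₀)) ![fderiv ℝ F (t, y₀) (0, v), fderiv ℝ F (t, y₀) (0, w)] =
        α' (e.symm (F (t, y₀))) ![mfderiv 𝓘(ℝ, E) 𝓘(ℝ, E) (fun p : M => c t • p) m v,
          mfderiv 𝓘(ℝ, E) 𝓘(ℝ, E) (fun p : M => c t • p) m w] := by
      rw [← hder, ← hder]
      exact α.inChart_two_apply m _ _ _
    have hα2 : α.inChart m y₀ ![v, w] = α' m ![v, w] := by
      have h1 := α.inChart_two_apply m y₀ v w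
      have h2 : ∀ p : M, p = m → ∀ A : E →L[ℝ] E, A = .id ℝ E →
          α' p ![A v, A w] = α' m ![v, w] := by
        rintro _ rfl _ rfl
        rfl
      exact h1.trans (h2 _ hem _ (mfderiv_extChartAt_symm_self m))
    have hα3 : α' (c t • m) ![mfderiv 𝓘(ℝ, E) 𝓘(ℝ, E) (fun p : M => c t • p) m v,
          mfderiv 𝓘(ℝ, E) 𝓘(ℝ, E) (fun p : M => c t • p) m w] = α' m ![v, w] := by
      have h1 := congrArg (fun l : E [⋀^Fin 2]→L[ℝ] ℝ => l ![v, w]) (congrFun (hK (c t)) m)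
      refine Eq.trans (congrArg (α' (c t • m)) ?_) h1
      funext i
      fin_cases i <;> rfl
    have hα4 : e.symm (F (t, y₀)) = c t • m := by
      have := e.left_inv hq.self_of_nhds
      exact this.trans (congrArg (c t • ·) hem)
    rw [hα1, hα2, hα4, hα3]
  have hXe : (fun y => (α.inChart m y).curryLeft (fderiv ℝ F (0, y) (1, 0))) =ᶠ[𝓝 y₀]
      (α.contract (fundamentalField ξ)).inChart m := by
    filter_upwards [hX] with y hy
    exact (α.inChart_contract_apply _ m hy).symm
  have hmain := extDeriv_add_extDeriv_curryLeft (hα.differentiableAt_inChart m) hF2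
    (Filter.mem_of_superset (extChartAt_target_mem_nhds m) hF0) hinv v w
  rw [hXe.extDeriv_eq] at hmain
  have hX0 : fderiv ℝ F (0, y₀) (1, 0) = (fundamentalField ξ m : E) := by
    have h1 := hX.self_of_nhds
    have h2 : ∀ p : M, p = m → ∀ A : E →L[ℝ] E, A = .id ℝ E → ∀ u : E,
        A u = fundamentalField ξ p → u = fundamentalField ξ m := by
      rintro _ rfl _ rfl u hu
      exact hu
    exact h2 _ hem _ (mfderiv_extChartAt_symm_self m) _ h1
  rw [DiffForm.d_apply, DiffForm.d_apply, ← hmain, ← hX0]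
  rfl

end Manifold

/-! ### Complex structure, forms of type (1,1) and complexified orbits. -/

section Complex

lemma isManifold_real_of_complex {E : Type*} [NormedAddCommGroup E] [NormedSpace ℂ E]
    {M : Type*} [TopologicalSpace M] [ChartedSpace E M] [IsManifold 𝓘(ℂ, E) ∞ M] :
    IsManifold 𝓘(ℝ, E) ∞ M := by
  refine isManifold_of_contDiffOn _ _ _ fun e e' he he' => ?_
  exact ((contDiffGroupoid ∞ 𝓘(ℂ, E)).compatible he he').1.restrict_scalars ℝ

variable {E : Type*} [NormedAddCommGroup E] [NormedSpace ℂ E]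
  {M : Type*} [TopologicalSpace M] [ChartedSpace E M]
  {E' : Type*} [NormedAddCommGroup E'] [NormedSpace ℂ E']
  {M' : Type*} [TopologicalSpace M'] [ChartedSpace E' M']

lemma hasMFDerivAt_real_of_complex {f : M → M'} {x : M}
    (hf : MDifferentiableAt 𝓘(ℂ, E) 𝓘(ℂ, E') f x) :
    HasMFDerivAt 𝓘(ℝ, E) 𝓘(ℝ, E') f x
      ((mfderiv 𝓘(ℂ, E) 𝓘(ℂ, E') f x : E →L[ℂ] E').restrictScalars ℝ : E →L[ℝ] E') :=
  ⟨hf.hasMFDerivAt.1, HasFDerivWithinAt.restrictScalars ℝ hf.hasMFDerivAt.2⟩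

/-- The real differential of a holomorphic map is its complex differential with scalars restricted.
-/
lemma mfderiv_J_apply {f : M → M'} {x : M} (hf : MDifferentiableAt 𝓘(ℂ, E) 𝓘(ℂ, E') f x)
    (v : TangentSpace 𝓘(ℝ, E) x) :
    mfderiv 𝓘(ℝ, E) 𝓘(ℝ, E') f x (J E x v) =
      J E' (f x) (mfderiv 𝓘(ℝ, E) 𝓘(ℝ, E') f x v) := by
  rw [(hasMFDerivAt_real_of_complex hf).mfderiv]
  exact (mfderiv 𝓘(ℂ, E) 𝓘(ℂ, E') f x : E →L[ℂ] E').map_smul Complex.I v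

/-- Charts are holomorphic, so in a chart `J` is the constant map `i`; this lets the invariance be
differentiated. -/
lemma DiffForm.IsJInvariant.inChart_apply [IsManifold 𝓘(ℂ, E) ∞ M] {α : DiffForm E M 2}
    (hα : α.IsJInvariant) (m : M) {y : E} (hy : y ∈ (extChartAt 𝓘(ℝ, E) m).target) (v w : E) :
    α.inChart m y ![Complex.I • v, Complex.I • w] = α.inChart m y ![v, w] := by
  have hd : MDifferentiableAt 𝓘(ℂ, E) 𝓘(ℂ, E) (extChartAt 𝓘(ℝ, E) m).symm y :=
    ((contMDiffOn_extChartAt_symm (I := 𝓘(ℂ, E)) (n := ∞) m).contMDiffAt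
      (extChartAt_target_mem_nhds' (I := 𝓘(ℂ, E)) hy)).mdifferentiableAt (by simp)
  have h := fun z : E => mfderiv_J_apply hd z
  rw [α.inChart_two_apply, α.inChart_two_apply,
    ← hα ((extChartAt 𝓘(ℝ, E) m).symm y) (mfderiv _ _ _ y v), ← h, ← h]
  rfl

/-- The exterior derivative of a `J`-invariant two-form has no components of type `(3,0)` and
`(0,3)`. -/
lemma DiffForm.IsJInvariant.d_apply [IsManifold 𝓘(ℂ, E) ∞ M] {α : DiffForm E M 2}
    (hs : α.IsSmooth) (hα : α.IsJInvariant) (m : M) (u v w : TangentSpace 𝓘(ℝ, E) m) :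
    α.d m ![J E m u, J E m v, J E m w] =
      α.d m ![u, v, J E m w] + α.d m ![u, J E m v, w] + α.d m ![J E m u, v, w] := by
  have : IsManifold 𝓘(ℝ, E) ∞ M := isManifold_real_of_complex
  simp only [DiffForm.d_apply]
  refine extDeriv_apply_of_invariant (j := Complex.I • ContinuousLinearMap.id ℝ E) (fun z => ?_)
    (hs.differentiableAt_inChart m) ?_ u v w
  · simp [smul_smul]
  · filter_upwards [extChartAt_target_mem_nhds (I := 𝓘(ℝ, E)) m] with y hy a b
    exact hα.inChart_apply m hy a b

lemma three_form_apply_eq_zero {V : Type*} [AddCommGroup V] [Module ℝ V]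
    {σ : V [⋀^Fin 3]→ₗ[ℝ] ℝ} {S : Set V} {j : V → V}
    (hS : ∀ s ∈ S, ∀ v w, σ ![s, v, w] = 0)
    (hj : ∀ u v w, σ ![j u, j v, j w] = σ ![u, v, j w] + σ ![u, j v, w] + σ ![j u, v, w])
    {a b c a' b' c' : V} (ha : a ∈ S) (hb : b ∈ S) (hc : c ∈ S)
    (ha' : a' ∈ S) (hb' : b' ∈ S) :
    σ ![a + j a', b + j b', c + j c'] = 0 := by
  have hS2 : ∀ s ∈ S, ∀ v w, σ ![v, s, w] = 0 := by
    intro s hs v w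
    have h := σ.map_swap ![s, v, w] (i := 0) (j := 1) (by decide)
    rw [hS s hs, neg_zero] at h
    refine Eq.trans (congrArg σ ?_) h
    funext i
    fin_cases i <;> rfl
  have hS3 : ∀ s ∈ S, ∀ v w, σ ![v, w, s] = 0 := by
    intro s hs v w
    have h := σ.map_swap ![s, w, v] (i := 0) (j := 2) (by decide)
    rw [hS s hs, neg_zero] at h
    refine Eq.trans (congrArg σ ?_) h
    funext i
    fin_cases i <;> rfl
  have h1 : ∀ x y z w, σ ![x + y, z, w] = σ ![x, z, w] + σ ![y, z, w] := fun x y z w =>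
    σ.map_vecCons_add ![z, w] x y
  have h2 : ∀ x y z w, σ ![z, x + y, w] = σ ![z, x, w] + σ ![z, y, w] := by
    intro x y z w
    have e : ∀ t, Function.update ![z, 0, w] 1 t = ![z, t, w] := by
      intro t
      funext i
      fin_cases i <;> rfl
    simpa only [e] using σ.map_update_add ![z, 0, w] 1 x y
  have h3 : ∀ x y z w, σ ![z, w, x + y] = σ ![z, w, x] + σ ![z, w, y] := by
    intro x y z w
    have e : ∀ t, Function.update ![z, w, 0] 2 t = ![z, w, t] := by
      intro t
      funext i
      fin_cases i <;> rfl
    simpa only [e] using σ.map_update_add ![z, w, 0] 2 x y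
  -- After `hj`, each of the three terms contains `a'` or `b'` without `j`, so nothing is needed of
  -- `c'`.
  rw [h1, hS a ha, h2, hS2 b hb, h3, hS3 c hc, hj, hS a' ha', hS a' ha', hS2 b' hb']
  simp

section Orbit

variable {EK : Type*} [NormedAddCommGroup EK] [NormedSpace ℝ EK]
  {K : Type*} [TopologicalSpace K] [ChartedSpace EK K] [Group K] [MulAction K M]
  {EG : Type*} [NormedAddCommGroup EG] [NormedSpace ℂ EG]
  {G : Type*} [TopologicalSpace G] [ChartedSpace EG G] [Group G]
  [MulAction G M] [ContMDiffSMul 𝓘(ℂ, EG) 𝓘(ℂ, E) ∞ G M]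

lemma mdifferentiableAt_orbitMap (m : M) (g : G) :
    MDifferentiableAt 𝓘(ℂ, EG) 𝓘(ℂ, E) (fun g : G => g • m) g :=
  (((contMDiff_smul (I := 𝓘(ℂ, EG)) (I' := 𝓘(ℂ, E)) (n := ∞)).comp
    (contMDiff_id.prodMk contMDiff_const)).mdifferentiable (by simp)) g

lemma fundamentalField_J (Ξ : GroupLieAlgebra 𝓘(ℝ, EG) G) (m : M) :
    (fundamentalField (J EG (1 : G) Ξ) m : TangentSpace 𝓘(ℝ, E) m) =
      J E m (fundamentalField Ξ m) :=
  mfderiv_J_apply (mdifferentiableAt_orbitMap m (1 : G)) Ξ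

/-- The orbit map of `K` is that of `G` composed with `φ`; apply the chain rule at `1`. -/
lemma fundamentalField_lieMap {φ : K →* G} (hφ : MDifferentiableAt 𝓘(ℝ, EK) 𝓘(ℝ, EG) φ 1)
    (hact : ∀ (k : K) (m : M), φ k • m = k • m) (ξ : GroupLieAlgebra 𝓘(ℝ, EK) K) (m : M) :
    (fundamentalField (lieMap EK EG φ ξ) m : TangentSpace 𝓘(ℝ, E) m) = fundamentalField ξ m := by
  have h1 : MDifferentiableAt 𝓘(ℝ, EG) 𝓘(ℝ, E) (fun g : G => g • m) (φ 1) :=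
    (hasMFDerivAt_real_of_complex (mdifferentiableAt_orbitMap m (φ 1))).mdifferentiableAt
  have h2 := h1.hasMFDerivAt.comp (1 : K) hφ.hasMFDerivAt
  have h3 : (fun g : G => g • m) ∘ φ = fun k : K => k • m := funext fun k => hact k m
  rw [h3] at h2
  have h4 := congrArg (fun l : EK →L[ℝ] E => l ξ) h2.mfderiv
  have h5 : ∀ g : G, g = 1 → (mfderiv 𝓘(ℝ, EG) 𝓘(ℝ, E) (fun g : G => g • m) g
      (lieMap EK EG φ ξ : EG) : E) = fundamentalField (lieMap EK EG φ ξ) m := by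
    rintro _ rfl
    rfl
  exact ((h4.trans (h5 _ φ.map_one))).symm

lemma IsComplexification.exists_eq_add_J {φ : K →* G} (hφ : IsComplexification EK EG φ)
    (Ξ : GroupLieAlgebra 𝓘(ℝ, EG) G) :
    ∃ ξ η, Ξ = lieMap EK EG φ ξ + J EG (1 : G) (lieMap EK EG φ η) := by
  have h : Ξ ∈ (lieMap EK EG φ).range ⊔ (lieMap EK EG φ).range.map (J EG (1 : G)).toLinearMap := by
    rw [hφ.isCompl.sup_eq_top]
    trivial
  obtain ⟨_, ⟨ξ, rfl⟩, _, ⟨_, ⟨η, rfl⟩, rfl⟩, rfl⟩ := Submodule.mem_sup.1 h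
  exact ⟨ξ, η, rfl⟩

lemma IsComplexification.orbitTangentSpace_subset {φ : K →* G} (hφ : IsComplexification EK EG φ)
    (hact : ∀ (k : K) (m : M), φ k • m = k • m) {m : M} {v : TangentSpace 𝓘(ℝ, E) m}
    (hv : v ∈ orbitTangentSpace E EG G m) :
    ∃ a ∈ orbitTangentSpace E EK K m, ∃ b ∈ orbitTangentSpace E EK K m, v = a + J E m b := by
  obtain ⟨Ξ, rfl⟩ := hv
  obtain ⟨ξ, η, rfl⟩ := hφ.exists_eq_add_J Ξ
  have hd := (hφ.contMDiff.mdifferentiable (by simp)) 1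
  refine ⟨_, ⟨ξ, rfl⟩, _, ⟨η, rfl⟩, ?_⟩
  dsimp only
  rw [← fundamentalField_lieMap hd hact, ← fundamentalField_lieMap hd hact, ← fundamentalField_J]
  exact map_add (mfderiv 𝓘(ℝ, EG) 𝓘(ℝ, E) (fun g : G => g • m) 1) _ _

end Orbit

end Complex

/-- The exterior derivative of an invariant momentumly closed two-form vanishes as soon as one
argument is tangent to the orbit. -/
lemma d_apply_eq_zero_of_mem_orbitTangentSpace
    {E : Type*} [NormedAddCommGroup E] [NormedSpace ℝ E]
    {M : Type*} [TopologicalSpace M] [ChartedSpace E M] [IsManifold 𝓘(ℝ, E) ∞ M]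
    {EK : Type*} [NormedAddCommGroup EK] [NormedSpace ℝ EK]
    {K : Type*} [TopologicalSpace K] [ChartedSpace EK K] [Group K] [LieGroup 𝓘(ℝ, EK) ∞ K]
    [MulAction K M] [ContMDiffSMul 𝓘(ℝ, EK) 𝓘(ℝ, E) ∞ K M] {α : DiffForm E M 2}
    (hα : α.IsSmooth) (hK : α.IsInvariant K) (hc : α.IsMomentumlyClosed EK K) {m : M}
    {u : TangentSpace 𝓘(ℝ, E) m} (hu : u ∈ orbitTangentSpace E EK K m)
    (v w : TangentSpace 𝓘(ℝ, E) m) : α.d m ![u, v, w] = 0 := by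
  obtain ⟨ξ, rfl⟩ := hu
  have h := DiffForm.IsInvariant.d_apply_fundamentalField hα hK ξ m v w
  rw [hc ξ] at h
  simpa using h

end MomentumlyClosed

end

open MomentumlyClosed in
/-- The first part is about a smooth action of a connected compact Lie group `K` on a smooth
manifold `M`, the second about a complex manifold `M` with a holomorphic action of the
complexification `G` of `K` that extends the `K`-action. -/
theorem mainTheorem11
    {EK : Type*} [NormedAddCommGroup EK] [NormedSpace ℝ EK] [FiniteDimensional ℝ EK]
    {K : Type*} [TopologicalSpace K] [ChartedSpace EK K] [Group K] [LieGroup 𝓘(ℝ, EK) ∞ K]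
    [CompactSpace K] [ConnectedSpace K] :
    (∀ {E : Type*} [NormedAddCommGroup E] [NormedSpace ℝ E] [FiniteDimensional ℝ E]
      {M : Type*} [TopologicalSpace M] [ChartedSpace E M] [IsManifold 𝓘(ℝ, E) ∞ M]
      [MulAction K M] [ContMDiffSMul 𝓘(ℝ, EK) 𝓘(ℝ, E) ∞ K M]
      (α : DiffForm E M 2),
      α.IsSmooth → α.IsInvariant K → α.IsMomentumlyClosed EK K →
        α.d.VanishesAlongOrbits EK K) ∧
    (∀ {E : Type*} [NormedAddCommGroup E] [NormedSpace ℂ E] [FiniteDimensional ℂ E]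
      {M : Type*} [TopologicalSpace M] [ChartedSpace E M] [IsManifold 𝓘(ℂ, E) ∞ M]
      [MulAction K M] [ContMDiffSMul 𝓘(ℝ, EK) 𝓘(ℝ, E) ∞ K M]
      {EG : Type*} [NormedAddCommGroup EG] [NormedSpace ℂ EG] [FiniteDimensional ℂ EG]
      {G : Type*} [TopologicalSpace G] [ChartedSpace EG G] [Group G] [LieGroup 𝓘(ℂ, EG) ∞ G]
      [MulAction G M] [ContMDiffSMul 𝓘(ℂ, EG) 𝓘(ℂ, E) ∞ G M]
      (φ : K →* G) (_ : IsComplexification EK EG φ)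
      (_ : ∀ (k : K) (m : M), φ k • m = k • m)
      (α : DiffForm E M 2),
      α.IsSmooth → α.IsInvariant K → α.IsMomentumlyClosed EK K → α.IsJInvariant →
        α.d.VanishesAlongOrbits EG G) := by
  refine ⟨?_, ?_⟩
  · intro E _ _ _ M _ _ _ _ _ α hα hK hc m p _ v hv
    have hvec : v = ![v 0, v 1, v 2] := by
      funext i
      fin_cases i <;> rfl
    rw [hvec]
    exact d_apply_eq_zero_of_mem_orbitTangentSpace hα hK hc (hv 0) _ _
  · intro E _ _ _ M _ _ _ _ _ EG _ _ _ G _ _ _ _ _ _ φ hφ hact α hα hK hc hJ m p _ v hv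
    have : IsManifold 𝓘(ℝ, E) ∞ M := isManifold_real_of_complex
    have hvec : v = ![v 0, v 1, v 2] := by
      funext i
      fin_cases i <;> rfl
    obtain ⟨a, ha, a', ha', h0⟩ := hφ.orbitTangentSpace_subset hact (hv 0)
    obtain ⟨b, hb, b', hb', h1⟩ := hφ.orbitTangentSpace_subset hact (hv 1)
    obtain ⟨c, hc', c', -, h2⟩ := hφ.orbitTangentSpace_subset hact (hv 2)
    rw [hvec, h0, h1, h2]
    exact three_form_apply_eq_zero (σ := (α.d p).toAlternatingMap)
      (S := orbitTangentSpace E EK K p) (j := J E p)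
      (fun s hs v w => d_apply_eq_zero_of_mem_orbitTangentSpace hα hK hc hs v w)
      (hJ.d_apply hα p) ha hb hc' ha' hb'
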